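/- Let $m$ be a positive integer, $n=2m$, and let $\mathrm{Tr}_1^m:\mathbb F_{2^m}\to\mathbb F_2$ and $\mathrm{Tr}_1^n:\mathbb F_{2^n}\to\mathbb F_2$ be the absolute trace functions, where $\mathbb F_{2^m}\subset\mathbb F_{2^n}$. Let $\lambda_1,\lambda_2,\lambda_3\in\mathbb F_{2^m}$ be linearly independent over $\mathbb F_2$ and put $$f(x)=\prod_{i=1}^{3}\mathrm{Tr}_1^m\big(\lambda_i x^{2^m+1}\big),\qquad x\in\mathbb F_{2^n}.$$ Define $t_1,t_2,t_3,t_4\in\{0,1\}$ by: $t_1=0$ if $(\lambda_1+\lambda_2+\lambda_3)^{-1}=\lambda_1^{-1}+\lambda_2^{-1}+\lambda_3^{-1}$ and $t_1=1$ otherwise; and, for $1\le j_1<j_2\le 3$, $t_{j_1+j_2-1}=0$ if $(\lambda_{j_1}+\lambda_{j_2})^{-1}=\lambda_{j_1}^{-1}+\lambda_{j_2}^{-1}$ and $t_{j_1+j_2-1}=1$ otherwise. Let $\mathrm{wt}$ denote the Hamming weight, and assume that the $\mathbb F_2$-linear span of $$\big\{\lambda_1^{-1},\ \lambda_2^{-1},\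 \lambda_3^{-1},\ (\lambda_1+\lambda_3)^{-1},\ (\lambda_1+\lambda_2)^{-1},\ (\lambda_2+\lambda_3)^{-1},\ (\lambda_1+\lambda_2+\lambda_3)^{-1}\big\}$$ has dimension $\mathrm{wt}(t_1,t_2,t_3,t_4)+3$ (so that $m\ge \mathrm{wt}(t_1,t_2,t_3,t_4)+3$). Let $$\mathcal C_f^{\star}=\big\{\big(\alpha f(x)-\mathrm{Tr}_1^n(\beta x)\big)_{x\in\mathbb F_{2^n}\setminus\{0\}}\ :\ \alpha\in\mathbb F_2,\ \beta\in\mathbb F_{2^n}\big\}.$$ Then $\mathcal C_f^{\star}$ is a $[2^n-1,\ n+1,\ 2^{n-3}+2^{m-3}]$ binary linear code (length, dimension, minimum nonzero Hamming weight). It is minimal, i.e. whenever the support of a codeword $b$ is contained in the support of a nonzero codeword $a$, then $b$ is a scalar multiple of $a$. Its minimum and maximum nonzero weights satisfy $w_{\min}/w_{\max}<1/2$. Its complete weight distribution is as follows (all listed weights are distinct, and $\mathrm i$ runs over $\{0,1\}$). (1) If $(t_1,t_2,t_3,t_4)=(1,1,1,1)$: $$\begin{array}{ll}\text{Weight}&\text{Multiplicity}\\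 0&1\\ 2^{n-3}+2^{m-3}&1\\ 2^{n-1}-(-1)^{\mathrm i}2^{m-3}&35(2^{n-7}+2^{m-7})-\mathrm i(2^m+1)\\ 2^{n-1}-(-1)^{\mathrm i}3\cdot2^{m-3}&21(2^{n-7}+2^{m-7})\\ 2^{n-1}-(-1)^{\mathrm i}5\cdot2^{m-3}&7(2^{n-7}+2^{m-7})\\ 2^{n-1}-(-1)^{\mathrm i}7\cdot2^{m-3}&2^{n-7}+2^{m-7}\\ 2^{n-1}&2^n-1\end{array}$$ (2) If $t_1=1$ and $\mathrm{wt}(t_2,t_3,t_4)=2$: $$\begin{array}{ll}\text{Weight}&\text{Multiplicity}\\ 0&1\\ 2^{n-3}+2^{m-3}&1\\ 2^{n-1}-7\cdot2^{m-3}&2^{n-6}+2^{m-6}\\ 2^{n-1}-(-1)^{\mathrm i}2^{m-3}&(16+3\mathrm i)(2^{n-6}+2^{m-6})-\mathrm i(2^m+1)\\ 2^{n-1}-(-1)^{\mathrm i}3\cdot2^{m-3}&(9+3\mathrm i)(2^{n-6}+2^{m-6})\\ 2^{n-1}-(-1)^{\mathrm i}5\cdot2^{m-3}&(4-\mathrm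 i)(2^{n-6}+2^{m-6})\\ 2^{n-1}&2^n-1\end{array}$$ -/

import Mathlib

section Codes

variable {F : Type*} [Field F] [DecidableEq F] {ι : Type*} [Fintype ι]

/-- The set of Hamming weights of the nonzero codewords of a linear code. -/
def nonzeroWeights (C : Submodule F (ι → F)) : Set ℕ :=
  {w | ∃ c ∈ C, c ≠ 0 ∧ hammingNorm c = w}

/-- `C` is an `[N, k, d]` linear code: length `N`, dimension `k`, minimum nonzero Hamming
weight `d`. -/
def IsLinearCode (C : Submodule F (ι → F)) (N k d : ℕ) : Prop :=
  Fintype.card ι = N ∧ Module.finrank F C = k ∧ IsLeast (nonzeroWeights C) d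

/-- A linear code is minimal if every nonzero codeword `a` covers (in the sense of supports)
no codewords other than its scalar multiples. -/
def IsMinimalCode (C : Submodule F (ι → F)) : Prop :=
  ∀ a ∈ C, a ≠ 0 → ∀ b ∈ C, Function.support b ⊆ Function.support a → ∃ z : F, b = z • a

/-- The number of codewords of Hamming weight `w`. -/
noncomputable def weightCount (C : Submodule F (ι → F)) (w : ℕ) : ℕ :=
  Nat.card {c : C // hammingNorm (c : ι → F) = w}

/-- The list `T` of pairs (weight, multiplicity) is the complete weight distribution of `C`:
the listed weights are pairwise distinct, every listed weight is a natural number that is attained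
by exactly as many codewords as listed, and no other weight occurs. -/
def HasWeightDistribution (C : Submodule F (ι → F)) (T : List (ℤ × ℤ)) : Prop :=
  (T.map Prod.fst).Nodup ∧
  (∀ r ∈ T, ∃ w : ℕ, (w : ℤ) = r.1 ∧ (weightCount C w : ℤ) = r.2) ∧
  ∀ w : ℕ, (w : ℤ) ∉ T.map Prod.fst → weightCount C w = 0

end Codes

section Construction

variable {F : Type*} [Field F] {L : Type*} [Field L] [Algebra F L]

/-- The codeword map `(α, β) ↦ (α f(x) - Tr(β x))`, with `x` running over the nonzero
elements of `L`. -/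
noncomputable def codewordMap (f : L → F) : F × L →ₗ[F] ({x : L // x ≠ 0} → F) where
  toFun ab := fun x => ab.1 * f x - Algebra.trace F L (ab.2 * x)
  map_add' a b := by
    funext x
    simp only [Prod.fst_add, Prod.snd_add, add_mul, map_add, Pi.add_apply]
    ring
  map_smul' z a := by
    funext x
    simp only [Prod.smul_fst, Prod.smul_snd, smul_mul_assoc, map_smul, Pi.smul_apply,
      smul_eq_mul, RingHom.id_apply]
    ring

/-- The punctured code of all words `(α f(x) - Tr(β x))` indexed by `x ≠ 0`. -/
noncomputable def starCode (f : L → F) : Submodule F ({x : L // x ≠ 0} → F) :=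
  LinearMap.range (codewordMap f)

end Construction

section CubicFunction

variable {K L : Type*} [Field K] [Field L] [Algebra K L]

/-- If `K` has `2 ^ m` and `L ⊇ K` has `2 ^ (2 * m)` elements, then `x ^ (2 ^ m + 1)` lies
in `K` for every `x` in `L`. -/
theorem exists_algebraMap_eq_pow {m : ℕ} (hK : Nat.card K = 2 ^ m)
    (hL : Nat.card L = 2 ^ (2 * m)) (x : L) :
    ∃ y : K, algebraMap K L y = x ^ (2 ^ m + 1) := by
  have hfK : Finite K := Nat.finite_of_card_ne_zero (by rw [hK]; positivity)
  have hfL : Finite L := Nat.finite_of_card_ne_zero (by rw [hL]; positivity)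
  refine ⟨Algebra.norm K x, ?_⟩
  rw [FiniteField.algebraMap_norm_eq_pow]
  congr 1
  have h1 : 1 < 2 ^ m := by rw [← hK]; exact Finite.one_lt_card
  rw [hK, hL]
  refine Nat.div_eq_of_eq_mul_left (by omega) ?_
  have h2 := Nat.mul_self_sub_mul_self_eq (2 ^ m) 1
  rw [one_mul] at h2
  rw [pow_mul', sq, h2]

/-- The power `x ^ (2 ^ m + 1)` of `x ∈ L`, as an element of the subfield `K`. -/
noncomputable def subfieldPow {m : ℕ} (hK : Nat.card K = 2 ^ m)
    (hL : Nat.card L = 2 ^ (2 * m)) (x : L) : K :=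
  (exists_algebraMap_eq_pow hK hL x).choose

theorem algebraMap_subfieldPow {m : ℕ} (hK : Nat.card K = 2 ^ m)
    (hL : Nat.card L = 2 ^ (2 * m)) (x : L) :
    algebraMap K L (subfieldPow hK hL x) = x ^ (2 ^ m + 1) :=
  (exists_algebraMap_eq_pow hK hL x).choose_spec

/-- The Boolean function `x ↦ ∏ i, Tr(lam i * x ^ (2 ^ m + 1))` on `L`, where `Tr` is the absolute
trace of `K`. -/
noncomputable def cubicFun [Algebra (ZMod 2) K] {m : ℕ} (hK : Nat.card K = 2 ^ m)
    (hL : Nat.card L = 2 ^ (2 * m)) (lam : Fin 3 → K) (x : L) : ZMod 2 :=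
  ∏ i, Algebra.trace (ZMod 2) K (lam i * subfieldPow hK hL x)

open Classical in
/-- The vector `(t₁, t₂, t₃, t₄)`: an entry is `0` if inversion is additive on `lam 0, lam 1, lam 2`,
respectively on the pairs `(0, 1)`, `(0, 2)`, `(1, 2)`, and `1` otherwise. -/
noncomputable def tVec (lam : Fin 3 → K) : Fin 4 → ZMod 2 :=
  ![if (lam 0 + lam 1 + lam 2)⁻¹ = (lam 0)⁻¹ + (lam 1)⁻¹ + (lam 2)⁻¹ then 0 else 1,
    if (lam 0 + lam 1)⁻¹ = (lam 0)⁻¹ + (lam 1)⁻¹ then 0 else 1,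
    if (lam 0 + lam 2)⁻¹ = (lam 0)⁻¹ + (lam 2)⁻¹ then 0 else 1,
    if (lam 1 + lam 2)⁻¹ = (lam 1)⁻¹ + (lam 2)⁻¹ then 0 else 1]

/-- The set of inverses of all nonempty partial sums of `lam 0, lam 1, lam 2`. -/
def inverseSums (lam : Fin 3 → K) : Set K :=
  {(lam 0)⁻¹, (lam 1)⁻¹, (lam 2)⁻¹, (lam 0 + lam 2)⁻¹, (lam 0 + lam 1)⁻¹, (lam 1 + lam 2)⁻¹,
    (lam 0 + lam 1 + lam 2)⁻¹}

end CubicFunction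

/-- Pairs (weight, multiplicity) for `t = (1, 1, 1, 1)`, with `n = 2 * m`. It is used only where
`7 ≤ m`, so that no exponent is truncated. -/
def tableFull (m : ℕ) : List (ℤ × ℤ) :=
  let n := 2 * m
  [(0, 1),
   (2 ^ (n - 3) + 2 ^ (m - 3), 1),
   (2 ^ (n - 1) - 2 ^ (m - 3), 35 * (2 ^ (n - 7) + 2 ^ (m - 7))),
   (2 ^ (n - 1) + 2 ^ (m - 3), 35 * (2 ^ (n - 7) + 2 ^ (m - 7)) - (2 ^ m + 1)),
   (2 ^ (n - 1) - 3 * 2 ^ (m - 3), 21 * (2 ^ (n - 7) + 2 ^ (m - 7))),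
   (2 ^ (n - 1) + 3 * 2 ^ (m - 3), 21 * (2 ^ (n - 7) + 2 ^ (m - 7))),
   (2 ^ (n - 1) - 5 * 2 ^ (m - 3), 7 * (2 ^ (n - 7) + 2 ^ (m - 7))),
   (2 ^ (n - 1) + 5 * 2 ^ (m - 3), 7 * (2 ^ (n - 7) + 2 ^ (m - 7))),
   (2 ^ (n - 1) - 7 * 2 ^ (m - 3), 2 ^ (n - 7) + 2 ^ (m - 7)),
   (2 ^ (n - 1) + 7 * 2 ^ (m - 3), 2 ^ (n - 7) + 2 ^ (m - 7)),
   (2 ^ (n - 1), 2 ^ n - 1)]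

/-- Pairs (weight, multiplicity) for `t₁ = 1`, `wt(t₂, t₃, t₄) = 2`, with `n = 2 * m`. It is used
only where `6 ≤ m`, so that no exponent is truncated. -/
def tableDeficient (m : ℕ) : List (ℤ × ℤ) :=
  let n := 2 * m
  [(0, 1),
   (2 ^ (n - 3) + 2 ^ (m - 3), 1),
   (2 ^ (n - 1) - 7 * 2 ^ (m - 3), 2 ^ (n - 6) + 2 ^ (m - 6)),
   (2 ^ (n - 1) - 2 ^ (m - 3), 16 * (2 ^ (n - 6) + 2 ^ (m - 6))),
   (2 ^ (n - 1) + 2 ^ (m - 3), 19 * (2 ^ (n - 6) + 2 ^ (m - 6)) - (2 ^ m + 1)),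
   (2 ^ (n - 1) - 3 * 2 ^ (m - 3), 9 * (2 ^ (n - 6) + 2 ^ (m - 6))),
   (2 ^ (n - 1) + 3 * 2 ^ (m - 3), 12 * (2 ^ (n - 6) + 2 ^ (m - 6))),
   (2 ^ (n - 1) - 5 * 2 ^ (m - 3), 4 * (2 ^ (n - 6) + 2 ^ (m - 6))),
   (2 ^ (n - 1) + 5 * 2 ^ (m - 3), 3 * (2 ^ (n - 6) + 2 ^ (m - 6))),
   (2 ^ (n - 1), 2 ^ n - 1)]

section CharacterSums

/-- The additive character `a ↦ (-1) ^ a` of `ZMod 2`, with integer values. -/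
def signChar (a : ZMod 2) : ℤ := if a = 0 then 1 else -1

theorem signChar_zero : signChar 0 = 1 := rfl

theorem signChar_add (a b : ZMod 2) : signChar (a + b) = signChar a * signChar b := by
  revert a b; decide

theorem signChar_mul_mul (a b c : ZMod 2) :
    4 * signChar (a * b * c) = 3 + signChar a + signChar b + signChar c - signChar (a + b)
      - signChar (a + c) - signChar (b + c) + signChar (a + b + c) := by
  revert a b c; decide

@[to_additive card_mul_sum_comp_addMonoidHom]
theorem card_mul_sum_comp_monoidHom {A B : Type*} [Group A] [Group B] [Fintype A] [Fintype B]
    (φ : A →* B) (hφ : Function.Surjective φ) (G : B → ℤ) :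
    (Fintype.card B : ℤ) * ∑ a, G (φ a) = Fintype.card A * ∑ b, G b := by
  classical
  have key (H : B → ℤ) : ∑ a, H (φ a) = (Finset.univ.filter fun a => φ a = 1).card * ∑ b, H b := by
    rw [← Finset.sum_fiberwise Finset.univ φ, Finset.mul_sum]
    refine Finset.sum_congr rfl fun b _ => ?_
    rw [← MonoidHom.card_fiber_eq_of_mem_range φ (hφ b) (hφ 1), ← nsmul_eq_mul,
      ← Finset.sum_const]
    refine Finset.sum_congr rfl fun a ha => ?_
    rw [(Finset.mem_filter.1 ha).2]
  have h1 := key fun _ => 1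
  simp only [Finset.sum_const, Finset.card_univ, nsmul_eq_mul, mul_one] at h1
  rw [key, h1]
  ring

theorem surjective_pi_trace {E : Type*} [Field E] [Finite E] [Algebra (ZMod 2) E] {k : ℕ}
    {e : Fin k → E} (he : LinearIndependent (ZMod 2) e) :
    Function.Surjective (LinearMap.pi fun i => Algebra.trace (ZMod 2) E ∘ₗ
      LinearMap.mulLeft (ZMod 2) (e i)) := by
  by_contra h
  rw [← LinearMap.range_eq_top, ← ne_eq, ← lt_top_iff_ne_top] at h
  obtain ⟨g, hg0, hg⟩ := Submodule.exists_le_ker_of_lt_top _ h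
  have hz (z : E) : Algebra.traceForm (ZMod 2) E (∑ i, g (Pi.single i 1) • e i) z = 0 := by
    have h1 := hg ⟨z, rfl⟩
    rw [LinearMap.mem_ker, ← LinearMap.sum_single_apply (fun _ : Fin k => ZMod 2)
      (LinearMap.pi _ z), map_sum] at h1
    rw [Algebra.traceForm_apply, Finset.sum_mul, map_sum, ← h1]
    refine Finset.sum_congr rfl fun i _ => ?_
    rw [smul_mul_assoc, map_smul]
    simp only [LinearMap.pi_apply, LinearMap.comp_apply, LinearMap.mulLeft_apply]
    conv_rhs => rw [← mul_one (Algebra.trace (ZMod 2) E (e i * z)),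
      ← smul_eq_mul (_ : ZMod 2), Pi.single_smul, map_smul]
    rw [smul_eq_mul, smul_eq_mul, mul_comm]
  have h0 := (traceForm_nondegenerate (ZMod 2) E).1 _ hz
  have hc := Fintype.linearIndependent_iff.1 he _ h0
  refine hg0 (LinearMap.pi_ext' fun i => LinearMap.ext_ring ?_)
  simpa using hc i

theorem two_pow_mul_sum_trace {E : Type*} [Field E] [Fintype E] [Algebra (ZMod 2) E] {k : ℕ}
    {e : Fin k → E} (he : LinearIndependent (ZMod 2) e) (G : (Fin k → ZMod 2) → ℤ) :
    2 ^ k * ∑ z, G (fun i => Algebra.trace (ZMod 2) E (e i * z)) =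
      Fintype.card E * ∑ u, G u := by
  have h := card_mul_sum_comp_addMonoidHom (LinearMap.pi fun i => Algebra.trace (ZMod 2) E ∘ₗ
      LinearMap.mulLeft (ZMod 2) (e i)).toAddMonoidHom (surjective_pi_trace he) G
  rw [← h]
  simp
  rfl

theorem sum_signChar_trace {E : Type*} [Field E] [Fintype E] [Algebra (ZMod 2) E] {c : E}
    (hc : c ≠ 0) : ∑ z, signChar (Algebra.trace (ZMod 2) E (c * z)) = 0 := by
  have h := two_pow_mul_sum_trace (e := fun _ : Fin 1 => c)
    (linearIndependent_unique_iff.2 hc) fun u => signChar (u 0)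
  have h2 : ∑ u : Fin 1 → ZMod 2, signChar (u 0) = 0 := by decide
  rw [h2, mul_zero] at h
  simpa using h

variable {K L : Type*} [Field K] [Field L] [Fintype K] [Fintype L] [Algebra K L] {m : ℕ}

theorem finrank_eq_two_of_card (hK : Nat.card K = 2 ^ m) (hL : Nat.card L = 2 ^ (2 * m)) :
    Module.finrank K L = 2 := by
  have h := Module.natCard_eq_pow_finrank (K := K) (V := L)
  have h1 : 1 < Nat.card K := Finite.one_lt_card
  rw [hL, mul_comm, pow_mul, ← hK] at h
  exact (Nat.pow_right_injective h1 h).symm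

theorem algebraMap_norm_eq (hK : Nat.card K = 2 ^ m) (hL : Nat.card L = 2 ^ (2 * m)) (x : L) :
    algebraMap K L (Algebra.norm K x) = x * x ^ 2 ^ m := by
  rw [FiniteField.algebraMap_norm_eq_prod_pow, finrank_eq_two_of_card hK hL, hK,
    Finset.prod_range_succ, Finset.prod_range_one, pow_zero, pow_one, pow_one]

theorem algebraMap_trace_eq (hK : Nat.card K = 2 ^ m) (hL : Nat.card L = 2 ^ (2 * m)) (x : L) :
    algebraMap K L (Algebra.trace K L x) = x + x ^ 2 ^ m := by
  rw [FiniteField.algebraMap_trace_eq_sum_pow, finrank_eq_two_of_card hK hL, hK,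
    Finset.sum_range_succ, Finset.sum_range_one, pow_zero, pow_one, pow_one]

theorem subfieldPow_eq_norm (hK : Nat.card K = 2 ^ m) (hL : Nat.card L = 2 ^ (2 * m)) (x : L) :
    subfieldPow hK hL x = Algebra.norm K x := by
  apply (algebraMap K L).injective
  rw [algebraMap_subfieldPow, algebraMap_norm_eq hK hL, pow_succ, mul_comm]

theorem sum_units {E : Type*} [Field E] [Fintype E] [DecidableEq E] (H : E → ℤ) :
    ∑ u : Eˣ, H u = ∑ x, H x - H 0 := by
  rw [Fintype.sum_eq_add_sum_subtype_ne H 0, add_sub_cancel_left]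
  exact Fintype.sum_equiv unitsEquivNeZero _ _ fun u => rfl

theorem sum_norm (hK : Nat.card K = 2 ^ m) (hL : Nat.card L = 2 ^ (2 * m)) (G : K → ℤ) :
    ∑ x : L, G (Algebra.norm K x) = G 0 + (2 ^ m + 1) * (∑ y, G y - G 0) := by
  classical
  have h := card_mul_sum_comp_monoidHom (Units.map (Algebra.norm K (S := L)))
    (FiniteField.unitsMap_norm_surjective K L) fun y => G y
  have cK : (Fintype.card Kˣ : ℤ) = 2 ^ m - 1 := by
    rw [Fintype.card_units, ← Nat.card_eq_fintype_card, hK]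
    push_cast [Nat.one_le_two_pow]; ring
  have cL : (Fintype.card Lˣ : ℤ) = (2 ^ m - 1) * (2 ^ m + 1) := by
    rw [Fintype.card_units, ← Nat.card_eq_fintype_card, hL]
    push_cast [Nat.one_le_two_pow]; ring
  have hm : (2 ^ m - 1 : ℤ) ≠ 0 := by
    rw [← cK]; exact_mod_cast Fintype.card_ne_zero
  simp only [Units.coe_map] at h
  rw [sum_units fun x : L => G (Algebra.norm K x), sum_units G, cK, cL, mul_assoc] at h
  have h2 := mul_left_cancel₀ hm h
  rw [Algebra.norm_zero] at h2
  linarith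

variable [Algebra (ZMod 2) K] [Algebra (ZMod 2) L]

omit [Fintype K] [Fintype L] in
theorem isScalarTower_zmod : IsScalarTower (ZMod 2) K L :=
  IsScalarTower.of_algebraMap_eq' (Subsingleton.elim _ _)

omit [Algebra (ZMod 2) K] in
theorem norm_add_eq (hK : Nat.card K = 2 ^ m) (hL : Nat.card L = 2 ^ (2 * m)) (x c : L) :
    Algebra.norm K (x + c) =
      Algebra.norm K x + Algebra.norm K c + Algebra.trace K L (c ^ 2 ^ m * x) := by
  apply (algebraMap K L).injective
  have : CharP L 2 := charP_of_injective_algebraMap (algebraMap (ZMod 2) L).injective 2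
  have hc : (c ^ 2 ^ m) ^ 2 ^ m = c := by
    rw [← pow_mul, ← pow_add, ← two_mul, ← hL, Nat.card_eq_fintype_card, FiniteField.pow_card]
  rw [(algebraMap K L).map_add, (algebraMap K L).map_add, algebraMap_norm_eq hK hL,
    algebraMap_norm_eq hK hL, algebraMap_norm_eq hK hL, algebraMap_trace_eq hK hL, mul_pow, hc, add_pow_char_pow]
  ring

/-- The Walsh transform of the elliptic quadratic form `x ↦ Tr (c * N x)`. -/
theorem sum_signChar_trace_norm (hK : Nat.card K = 2 ^ m) (hL : Nat.card L = 2 ^ (2 * m)) {c : K}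
    (hc : c ≠ 0) (b : L) :
    ∑ x : L, signChar (Algebra.trace (ZMod 2) K (c * Algebra.norm K x)
      + Algebra.trace (ZMod 2) L (b * x)) =
    -2 ^ m * signChar (Algebra.trace (ZMod 2) K (c⁻¹ * Algebra.norm K b)) := by
  have := isScalarTower_zmod (K := K) (L := L)
  have : CharP L 2 := charP_of_injective_algebraMap (algebraMap (ZMod 2) L).injective 2
  have : CharP K 2 := charP_of_injective_algebraMap (algebraMap (ZMod 2) K).injective 2
  have hcL : algebraMap K L c ≠ 0 := by simpa using hc
  set d : L := (b / algebraMap K L c) ^ 2 ^ m with hd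
  have hd1 : d ^ 2 ^ m = b / algebraMap K L c := by
    rw [hd, ← pow_mul, ← pow_add, ← two_mul, ← hL, Nat.card_eq_fintype_card, FiniteField.pow_card]
  have hNd : Algebra.norm K d = c⁻¹ * c⁻¹ * Algebra.norm K b := by
    apply (algebraMap K L).injective
    have hcq : algebraMap K L c ^ 2 ^ m = algebraMap K L c := by
      rw [← map_pow, ← hK, Nat.card_eq_fintype_card, FiniteField.pow_card]
    rw [algebraMap_norm_eq hK hL, hd1, hd, map_mul, map_mul, algebraMap_norm_eq hK hL, div_pow,
      hcq, map_inv₀]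
    field_simp
  have hx (x : L) : Algebra.trace (ZMod 2) K (c * Algebra.norm K x)
      + Algebra.trace (ZMod 2) L (b * x) = Algebra.trace (ZMod 2) K (c * Algebra.norm K (x + d))
      + Algebra.trace (ZMod 2) K (c⁻¹ * Algebra.norm K b) := by
    rw [← Algebra.trace_trace (S := K) (b * x), ← map_add, ← map_add, norm_add_eq hK hL, hd1, hNd]
    congr 1
    have h1 : Algebra.trace K L (b * x) = c * Algebra.trace K L (b / algebraMap K L c * x) := by
      rw [← smul_eq_mul c, ← map_smul, Algebra.smul_def]
      congr 1
      field_simp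
    have h2 : c * (c⁻¹ * c⁻¹ * Algebra.norm K b) = c⁻¹ * Algebra.norm K b := by
      field_simp
    rw [h1, mul_add, mul_add, h2]
    linear_combination -CharTwo.add_self_eq_zero (c⁻¹ * Algebra.norm K b)
  simp_rw [hx, signChar_add]
  have hshift := Equiv.sum_comp (Equiv.addRight d) fun x : L =>
    signChar (Algebra.trace (ZMod 2) K (c * Algebra.norm K x))
  simp only [Equiv.coe_addRight] at hshift
  rw [← Finset.sum_mul, hshift,
    sum_norm hK hL fun y => signChar (Algebra.trace (ZMod 2) K (c * y)), sum_signChar_trace hc,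
    mul_zero, map_zero, signChar_zero]
  ring

end CharacterSums

section InverseSums

variable {K : Type*} [Field K] [Algebra (ZMod 2) K]

/-- The signed character sum over the inverses of the nonempty partial sums of `a, b, c`; up to a
scalar it is the Walsh coefficient of the cubic function at a nonzero point of norm `z`. -/
noncomputable def invSumChar (a b c z : K) : ℤ :=
  signChar (Algebra.trace (ZMod 2) K (a⁻¹ * z)) + signChar (Algebra.trace (ZMod 2) K (b⁻¹ * z))
    + signChar (Algebra.trace (ZMod 2) K (c⁻¹ * z))
    - signChar (Algebra.trace (ZMod 2) K ((a + b)⁻¹ * z))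
    - signChar (Algebra.trace (ZMod 2) K ((a + c)⁻¹ * z))
    - signChar (Algebra.trace (ZMod 2) K ((b + c)⁻¹ * z))
    + signChar (Algebra.trace (ZMod 2) K ((a + b + c)⁻¹ * z))

theorem abs_invSumChar_le (a b c z : K) : |invSumChar a b c z| ≤ 7 := by
  have h (u : ZMod 2) : -1 ≤ signChar u ∧ signChar u ≤ 1 := by revert u; decide
  rw [abs_le, invSumChar]
  constructor <;> linarith [h (Algebra.trace (ZMod 2) K (a⁻¹ * z)),
    h (Algebra.trace (ZMod 2) K (b⁻¹ * z)), h (Algebra.trace (ZMod 2) K (c⁻¹ * z)),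
    h (Algebra.trace (ZMod 2) K ((a + b)⁻¹ * z)), h (Algebra.trace (ZMod 2) K ((a + c)⁻¹ * z)),
    h (Algebra.trace (ZMod 2) K ((b + c)⁻¹ * z)), h (Algebra.trace (ZMod 2) K ((a + b + c)⁻¹ * z))]

theorem invSumChar_zero (a b c : K) : invSumChar a b c 0 = 1 := by
  simp [invSumChar, signChar_zero]

theorem sum_seven_signChar (F : ℤ → ℤ) :
    ∑ u : Fin 7 → ZMod 2, F (signChar (u 0) + signChar (u 1) + signChar (u 2) - signChar (u 3)
      - signChar (u 4) - signChar (u 5) + signChar (u 6)) =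
    F 7 + 7 * F 5 + 21 * F 3 + 35 * F 1 + 35 * F (-1) + 21 * F (-3) + 7 * F (-5) + F (-7) := by
  have h : (Finset.univ : Finset (Fin 7 → ZMod 2)).val.map (fun u => signChar (u 0)
      + signChar (u 1) + signChar (u 2) - signChar (u 3)
      - signChar (u 4) - signChar (u 5) + signChar (u 6)) =
      .replicate 1 7 + .replicate 7 5 + .replicate 21 3 + .replicate 35 1 + .replicate 35 (-1)
      + .replicate 21 (-3) + .replicate 7 (-5) + .replicate 1 (-7) := by decide +kernel
  have h2 := congrArg (fun s => (s.map F).sum) h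
  simp only [Multiset.map_map, Multiset.map_add, Multiset.sum_add, Multiset.map_replicate,
    Multiset.sum_replicate, nsmul_eq_mul] at h2
  push_cast at h2
  rw [one_mul, one_mul] at h2
  exact h2

theorem sum_six_signChar (F : ℤ → ℤ) :
    ∑ u : Fin 6 → ZMod 2, F (signChar (u 0) + signChar (u 1) + signChar (u 2)
      - signChar (u 0 + u 1) - signChar (u 3) - signChar (u 4) + signChar (u 5)) =
    3 * F 5 + 12 * F 3 + 19 * F 1 + 16 * F (-1) + 9 * F (-3) + 4 * F (-5) + F (-7) := by
  have h : (Finset.univ : Finset (Fin 6 → ZMod 2)).val.map (fun u => signChar (u 0)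
      + signChar (u 1) + signChar (u 2) - signChar (u 0 + u 1)
      - signChar (u 3) - signChar (u 4) + signChar (u 5)) =
      .replicate 3 5 + .replicate 12 3 + .replicate 19 1 + .replicate 16 (-1)
      + .replicate 9 (-3) + .replicate 4 (-5) + .replicate 1 (-7) := by decide +kernel
  have h2 := congrArg (fun s => (s.map F).sum) h
  simp only [Multiset.map_map, Multiset.map_add, Multiset.sum_add, Multiset.map_replicate,
    Multiset.sum_replicate, nsmul_eq_mul] at h2
  push_cast at h2
  rw [one_mul] at h2
  exact h2

theorem linearIndependent_of_le_finrank_span {k : ℕ} {e : Fin k → K} {S : Set K} [Finite K]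
    (hS : S ⊆ Submodule.span (ZMod 2) (Set.range e))
    (hk : k ≤ Module.finrank (ZMod 2) (Submodule.span (ZMod 2) S)) :
    LinearIndependent (ZMod 2) e := by
  rw [linearIndependent_iff_card_le_finrank_span, Fintype.card_fin]
  exact hk.trans (Submodule.finrank_mono (Submodule.span_le.2 hS))

variable [Fintype K] {m k : ℕ}

theorem le_of_linearIndependent (hK : Nat.card K = 2 ^ m) {e : Fin k → K}
    (he : LinearIndependent (ZMod 2) e) : k ≤ m := by
  have h := Module.natCard_eq_pow_finrank (K := ZMod 2) (V := K)
  rw [hK, Nat.card_zmod] at h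
  have h2 := he.fintype_card_le_finrank
  rwa [← Nat.pow_right_injective le_rfl h, Fintype.card_fin] at h2

theorem sum_invSumChar_of_linearIndependent {a b c : K}
    (he : LinearIndependent (ZMod 2)
      ![a⁻¹, b⁻¹, c⁻¹, (a + b)⁻¹, (a + c)⁻¹, (b + c)⁻¹, (a + b + c)⁻¹]) (F : ℤ → ℤ) :
    2 ^ 7 * ∑ z, F (invSumChar a b c z) = Fintype.card K *
      (F 7 + 7 * F 5 + 21 * F 3 + 35 * F 1 + 35 * F (-1) + 21 * F (-3) + 7 * F (-5) + F (-7)) := by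
  rw [← sum_seven_signChar, ← two_pow_mul_sum_trace he]
  rfl

theorem sum_invSumChar_of_inv_add {a b c : K} (hab : (a + b)⁻¹ = a⁻¹ + b⁻¹)
    (he : LinearIndependent (ZMod 2) ![a⁻¹, b⁻¹, c⁻¹, (a + c)⁻¹, (b + c)⁻¹, (a + b + c)⁻¹])
    (F : ℤ → ℤ) :
    2 ^ 6 * ∑ z, F (invSumChar a b c z) = Fintype.card K *
      (3 * F 5 + 12 * F 3 + 19 * F 1 + 16 * F (-1) + 9 * F (-3) + 4 * F (-5) + F (-7)) := by
  rw [← sum_six_signChar, ← two_pow_mul_sum_trace he]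
  simp only [invSumChar, hab, add_mul, map_add]
  rfl

end InverseSums

section Weights

theorem two_mul_hammingNorm_eq {L : Type*} [Field L] [Fintype L] [DecidableEq L]
    (h : L → ZMod 2) (h0 : h 0 = 0) :
    2 * (hammingNorm (fun x : {x : L // x ≠ 0} => h x) : ℤ) =
      Fintype.card L - ∑ x, signChar (h x) := by
  have h1 (a : ZMod 2) : 2 * (if a ≠ 0 then 1 else 0 : ℤ) = 1 - signChar a := by
    revert a; decide
  rw [hammingNorm, Finset.card_filter]
  push_cast
  simp_rw [Finset.mul_sum, h1]
  rw [Finset.sum_sub_distrib,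
    Fintype.sum_eq_add_sum_subtype_ne (fun x => signChar (h x)) 0, h0, signChar_zero]
  have hc := Fintype.sum_eq_add_sum_subtype_ne (fun _ : L => (1 : ℤ)) 0
  simp only [Finset.sum_const, Finset.card_univ, nsmul_eq_mul, mul_one] at hc ⊢
  rw [hc]
  ring

theorem hammingNorm_codewordMap_zero {L : Type*} [Field L] [Fintype L] [DecidableEq L]
    [Algebra (ZMod 2) L] {m : ℕ} (hL : Nat.card L = 2 ^ (2 * m)) (f : L → ZMod 2) {b : L} (hb : b ≠ 0) {q : ℤ}
    (hq : 2 ^ m = 8 * q) : (hammingNorm (codewordMap f (0, b)) : ℤ) = 32 * q ^ 2 := by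
  have h := two_mul_hammingNorm_eq (fun x : L => 0 * f x - Algebra.trace (ZMod 2) L (b * x))
    (by simp)
  have hs := sum_signChar_trace hb
  simp only [zero_mul, zero_sub, ZMod.neg_eq_self_mod_two] at h
  rw [hs, ← Nat.card_eq_fintype_card, hL, Nat.cast_pow, Nat.cast_two, mul_comm 2 m, pow_mul,
    hq] at h
  have : (codewordMap f (0, b)) = fun x : {x : L // x ≠ 0} => Algebra.trace (ZMod 2) L (b * x) := by
    funext x
    simp [codewordMap, ZMod.neg_eq_self_mod_two]
  rw [this]
  linarith

variable {K L : Type*} [Field K] [Field L] [Fintype L] [DecidableEq L]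
  [Algebra (ZMod 2) K] [Algebra (ZMod 2) L] [Algebra K L] {m : ℕ}

variable (hK : Nat.card K = 2 ^ m) (hL : Nat.card L = 2 ^ (2 * m)) {lam : Fin 3 → K}

omit [DecidableEq L] [Algebra (ZMod 2) L] in
theorem cubicFun_eq (x : L) : cubicFun hK hL lam x =
    Algebra.trace (ZMod 2) K (lam 0 * Algebra.norm K x)
      * Algebra.trace (ZMod 2) K (lam 1 * Algebra.norm K x)
      * Algebra.trace (ZMod 2) K (lam 2 * Algebra.norm K x) := by
  have : Finite K := Finite.of_injective _ (algebraMap K L).injective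
  have := Fintype.ofFinite K
  rw [cubicFun, Fin.prod_univ_three, subfieldPow_eq_norm]

theorem hammingNorm_codewordMap_one_zero (hlam : LinearIndependent (ZMod 2) lam) {q : ℤ}
    (hq : 2 ^ m = 8 * q) :
    (hammingNorm (codewordMap (cubicFun hK hL lam : L → ZMod 2) (1, 0)) : ℤ) = 8 * q ^ 2 + q := by
  have : Finite K := Finite.of_injective _ (algebraMap K L).injective
  have := Fintype.ofFinite K
  have h := two_mul_hammingNorm_eq (cubicFun hK hL lam : L → ZMod 2) (by simp [cubicFun_eq])
  simp_rw [cubicFun_eq] at h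
  rw [sum_norm hK hL fun y => signChar (Algebra.trace (ZMod 2) K (lam 0 * y)
      * Algebra.trace (ZMod 2) K (lam 1 * y) * Algebra.trace (ZMod 2) K (lam 2 * y))] at h
  have h3 := two_pow_mul_sum_trace hlam fun u => signChar (u 0 * u 1 * u 2)
  have h4 : ∑ u : Fin 3 → ZMod 2, signChar (u 0 * u 1 * u 2) = 6 := by decide +kernel
  rw [h4, ← Nat.card_eq_fintype_card, hK, Nat.cast_pow, Nat.cast_two, hq] at h3
  have h5 : ∑ y, signChar (Algebra.trace (ZMod 2) K (lam 0 * y)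
      * Algebra.trace (ZMod 2) K (lam 1 * y) * Algebra.trace (ZMod 2) K (lam 2 * y)) = 6 * q := by
    linarith
  rw [h5, ← Nat.card_eq_fintype_card, hL, Nat.cast_pow, Nat.cast_two, mul_comm 2 m, pow_mul,
    hq] at h
  simp only [mul_zero, map_zero, signChar_zero] at h
  have : (codewordMap (cubicFun hK hL lam : L → ZMod 2) (1, 0)) =
      fun x : {x : L // x ≠ 0} => cubicFun hK hL lam (x : L) := by
    funext x
    simp [codewordMap]
  rw [this]
  simp_rw [cubicFun_eq]
  linarith

theorem hammingNorm_codewordMap_one (hlam : LinearIndependent (ZMod 2) lam) {q : ℤ}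
    (hq : 2 ^ m = 8 * q) {b : L} (hb : b ≠ 0) :
    (hammingNorm (codewordMap (cubicFun hK hL lam : L → ZMod 2) (1, b)) : ℤ) =
      32 * q ^ 2 + q * invSumChar (lam 0) (lam 1) (lam 2) (Algebra.norm K b) := by
  have : Finite K := Finite.of_injective _ (algebraMap K L).injective
  have := Fintype.ofFinite K
  have hne (g : Fin 3 → ZMod 2) (hg : g ≠ 0) : g 0 • lam 0 + g 1 • lam 1 + g 2 • lam 2 ≠ 0 := by
    intro h
    rw [← Fin.sum_univ_three fun i => g i • lam i] at h
    exact hg (funext (Fintype.linearIndependent_iff.1 hlam g h))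
  have hsplit (x : L) : 4 * signChar (cubicFun hK hL lam x + Algebra.trace (ZMod 2) L (b * x)) =
      3 * signChar (Algebra.trace (ZMod 2) L (b * x))
      + signChar (Algebra.trace (ZMod 2) K (lam 0 * Algebra.norm K x)
          + Algebra.trace (ZMod 2) L (b * x))
      + signChar (Algebra.trace (ZMod 2) K (lam 1 * Algebra.norm K x)
          + Algebra.trace (ZMod 2) L (b * x))
      + signChar (Algebra.trace (ZMod 2) K (lam 2 * Algebra.norm K x)
          + Algebra.trace (ZMod 2) L (b * x))
      - signChar (Algebra.trace (ZMod 2) K ((lam 0 + lam 1) * Algebra.norm K x)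
          + Algebra.trace (ZMod 2) L (b * x))
      - signChar (Algebra.trace (ZMod 2) K ((lam 0 + lam 2) * Algebra.norm K x)
          + Algebra.trace (ZMod 2) L (b * x))
      - signChar (Algebra.trace (ZMod 2) K ((lam 1 + lam 2) * Algebra.norm K x)
          + Algebra.trace (ZMod 2) L (b * x))
      + signChar (Algebra.trace (ZMod 2) K ((lam 0 + lam 1 + lam 2) * Algebra.norm K x)
          + Algebra.trace (ZMod 2) L (b * x)) := by
    simp only [add_mul, map_add]
    rw [cubicFun_eq, signChar_add, ← mul_assoc, signChar_mul_mul]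
    simp only [signChar_add]
    ring
  have hsum : 4 * ∑ x : L, signChar (cubicFun hK hL lam x + Algebra.trace (ZMod 2) L (b * x)) =
      -2 ^ m * invSumChar (lam 0) (lam 1) (lam 2) (Algebra.norm K b) := by
    rw [Finset.mul_sum, Finset.sum_congr rfl fun x _ => hsplit x]
    simp only [Finset.sum_add_distrib, Finset.sum_sub_distrib, ← Finset.mul_sum]
    rw [sum_signChar_trace hb,
      sum_signChar_trace_norm hK hL (by simpa using hne ![1, 0, 0] (by decide)),
      sum_signChar_trace_norm hK hL (by simpa using hne ![0, 1, 0] (by decide)),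
      sum_signChar_trace_norm hK hL (by simpa using hne ![0, 0, 1] (by decide)),
      sum_signChar_trace_norm hK hL (by simpa using hne ![1, 1, 0] (by decide)),
      sum_signChar_trace_norm hK hL (by simpa using hne ![1, 0, 1] (by decide)),
      sum_signChar_trace_norm hK hL (by simpa using hne ![0, 1, 1] (by decide)),
      sum_signChar_trace_norm hK hL (by simpa using hne ![1, 1, 1] (by decide)), invSumChar]
    ring
  have h := two_mul_hammingNorm_eq
    (fun x : L => cubicFun hK hL lam x + Algebra.trace (ZMod 2) L (b * x)) (by simp [cubicFun_eq])
  rw [← Nat.card_eq_fintype_card, hL, Nat.cast_pow, Nat.cast_two, mul_comm 2 m, pow_mul,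
    hq] at h
  rw [hq] at hsum
  have : (codewordMap (cubicFun hK hL lam : L → ZMod 2) (1, b)) = fun x : {x : L // x ≠ 0} =>
      cubicFun hK hL lam (x : L) + Algebra.trace (ZMod 2) L (b * x) := by
    funext x
    simp [codewordMap, sub_eq_add_neg, ZMod.neg_eq_self_mod_two]
  rw [this]
  linarith

end Weights

section CodeParameters

/-- The weights of the words `Φ (α, β)` are `32 q²` for `α = 0 ≠ β`, `8 q² + q` for `(1, 0)` and
`32 q² + q H(β)` for `α = 1`, `β ≠ 0`, where `|H| ≤ 7`. -/
structure HasCubicWeights {V ι : Type*} [AddCommGroup V] [Module (ZMod 2) V] [Fintype ι]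
    (Φ : ZMod 2 × V →ₗ[ZMod 2] (ι → ZMod 2)) (H : V → ℤ) (q : ℤ) : Prop where
  one_le : 1 ≤ q
  abs_le : ∀ b, |H b| ≤ 7
  zero : ∀ b ≠ 0, (hammingNorm (Φ (0, b)) : ℤ) = 32 * q ^ 2
  one_zero : (hammingNorm (Φ (1, 0)) : ℤ) = 8 * q ^ 2 + q
  one : ∀ b ≠ 0, (hammingNorm (Φ (1, b)) : ℤ) = 32 * q ^ 2 + q * H b

theorem hammingNorm_eq_add_of_support_subset {ι : Type*} [Fintype ι]
    {a b : ι → ZMod 2} (h : Function.support b ⊆ Function.support a) :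
    hammingNorm a = hammingNorm b + hammingNorm (a - b) := by
  have key (x y : ZMod 2) (h : y ≠ 0 → x ≠ 0) :
      (if x ≠ 0 then 1 else 0) = (if y ≠ 0 then 1 else 0) + if x - y ≠ 0 then 1 else 0 := by
    revert x y; decide
  simp only [hammingNorm, Finset.card_filter]
  rw [← Finset.sum_add_distrib]
  exact Finset.sum_congr rfl fun i _ => key (a i) (b i) fun hi => h hi

namespace HasCubicWeights

variable {V ι : Type*} [AddCommGroup V] [Module (ZMod 2) V] [Fintype ι]
  {Φ : ZMod 2 × V →ₗ[ZMod 2] (ι → ZMod 2)} {H : V → ℤ} {q : ℤ}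

theorem cases (hw : HasCubicWeights Φ H q) {u : ZMod 2 × V} (hu : u ≠ 0) :
    (u.1 = 0 ∧ (hammingNorm (Φ u) : ℤ) = 32 * q ^ 2) ∨
    (u.1 = 1 ∧ (hammingNorm (Φ u) : ℤ) = 8 * q ^ 2 + q) ∨
    (u.1 = 1 ∧ 32 * q ^ 2 - 7 * q ≤ (hammingNorm (Φ u) : ℤ) ∧
      (hammingNorm (Φ u) : ℤ) ≤ 32 * q ^ 2 + 7 * q) := by
  obtain ⟨x, b⟩ := u
  have hx : x = 0 ∨ x = 1 := by clear hu; revert x; decide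
  rcases hx with rfl | rfl
  · exact Or.inl ⟨rfl, hw.zero b fun h => hu (by rw [h]; rfl)⟩
  · by_cases hb : b = 0
    · exact Or.inr (Or.inl ⟨rfl, by rw [hb, hw.one_zero]⟩)
    · obtain ⟨h1, h2⟩ := _root_.abs_le.1 (hw.abs_le b)
      have := hw.one_le
      refine Or.inr (Or.inr ⟨rfl, ?_, ?_⟩) <;> rw [hw.one b hb] <;> nlinarith

theorem le_hammingNorm (hw : HasCubicWeights Φ H q) {u : ZMod 2 × V} (hu : u ≠ 0) :
    8 * q ^ 2 + q ≤ (hammingNorm (Φ u) : ℤ) := by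
  have := hw.one_le
  have := Int.le_self_sq q
  rcases hw.cases hu with h | h | h <;> linarith

theorem injective (hw : HasCubicWeights Φ H q) : Function.Injective Φ := by
  rw [injective_iff_map_eq_zero]
  intro u hu
  by_contra h
  have h1 := hw.le_hammingNorm h
  rw [hu, hammingNorm_zero] at h1
  have := hw.one_le
  have := Int.le_self_sq q
  push_cast at h1
  linarith

theorem isMinimalCode (hw : HasCubicWeights Φ H q) : IsMinimalCode (LinearMap.range Φ) := by
  rintro _ ⟨u, rfl⟩ - _ ⟨v, rfl⟩ hs
  by_cases hv : v = 0
  · exact ⟨0, by rw [hv, map_zero, zero_smul]⟩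
  by_cases huv : u - v = 0
  · exact ⟨1, by rw [sub_eq_zero.1 huv, one_smul]⟩
  by_cases hu : u = 0
  · refine absurd (hw.injective ?_) hv
    rw [map_zero]
    rw [hu, map_zero, Function.support_zero, Set.subset_empty_iff] at hs
    exact Function.support_eq_empty_iff.1 hs
  exfalso
  have h : (hammingNorm (Φ u) : ℤ) = hammingNorm (Φ v) + hammingNorm (Φ (u - v)) := by
    rw [map_sub, hammingNorm_eq_add_of_support_subset hs, Nat.cast_add]
  have h1 : u.1 = v.1 + (u - v).1 := by simp
  have := hw.one_le
  have := Int.le_self_sq q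
  rcases hw.cases hu with h2 | h2 | h2 <;> rcases hw.cases hv with h3 | h3 | h3 <;>
    rcases hw.cases huv with h4 | h4 | h4 <;>
    first
    | linarith
    | rw [h2.1, h3.1, h4.1] at h1
      exact absurd h1 (by decide)

theorem isLeast (hw : HasCubicWeights Φ H q) {d : ℕ} (hd : (d : ℤ) = 8 * q ^ 2 + q) :
    IsLeast (nonzeroWeights (LinearMap.range Φ)) d := by
  constructor
  · refine ⟨Φ (1, 0), ⟨_, rfl⟩, fun h => ?_, ?_⟩
    · have := congrArg Prod.fst (hw.injective (h.trans (map_zero Φ).symm))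
      exact one_ne_zero this
    · exact_mod_cast hw.one_zero.trans hd.symm
  · rintro _ ⟨_, ⟨u, rfl⟩, hu, rfl⟩
    have := hw.le_hammingNorm (u := u) fun h => hu (by rw [h, map_zero])
    rw [← hd] at this
    exact_mod_cast this

theorem exists_weight_ratio_lt [Nontrivial V] (hw : HasCubicWeights Φ H q) : ∃ wmin wmax : ℕ,
    IsLeast (nonzeroWeights (LinearMap.range Φ)) wmin ∧
    IsGreatest (nonzeroWeights (LinearMap.range Φ)) wmax ∧ (wmin : ℚ) / wmax < 1 / 2 := by
  have hmin := hw.isLeast hw.one_zero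
  have hbdd : BddAbove (nonzeroWeights (LinearMap.range Φ)) := by
    refine ⟨Fintype.card ι, ?_⟩
    rintro _ ⟨c, -, -, rfl⟩
    exact hammingNorm_le_card_fintype
  have hmax : IsGreatest (nonzeroWeights (LinearMap.range Φ)) _ :=
    ⟨Nat.sSup_mem ⟨_, hmin.1⟩ hbdd, fun w hw => le_csSup hbdd hw⟩
  refine ⟨_, _, hmin, hmax, ?_⟩
  obtain ⟨b, hb⟩ := exists_ne (0 : V)
  have h0 := hw.one_le
  have h1 := Int.le_self_sq q
  have h2 : Φ (0, b) ≠ 0 := fun h =>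
    hb (congrArg Prod.snd (hw.injective (h.trans (map_zero Φ).symm)))
  have h3 := hmax.2 ⟨Φ (0, b), ⟨_, rfl⟩, h2, rfl⟩
  have h4 : 2 * (hammingNorm (Φ (1, 0)) : ℤ) < hammingNorm (Φ (0, b)) := by
    rw [hw.one_zero, hw.zero b hb]
    linarith
  have h5 : 2 * hammingNorm (Φ (1, 0)) < sSup (nonzeroWeights (LinearMap.range Φ)) :=
    lt_of_lt_of_le (by exact_mod_cast h4) h3
  have h6 : (0 : ℚ) < (sSup (nonzeroWeights (LinearMap.range Φ)) : ℕ) := by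
    exact_mod_cast lt_of_le_of_lt (Nat.zero_le _) h5
  rw [div_lt_div_iff₀ h6 two_pos, one_mul, mul_comm]
  exact_mod_cast h5

theorem weightCount_eq [Fintype V] (hw : HasCubicWeights Φ H q) (w : ℕ) (δ : ℤ → ℤ) (hδ : ∀ x, δ x = if x = w then 1 else 0) :
    (weightCount (LinearMap.range Φ) w : ℤ) = δ 0 + (Fintype.card V - 1) * δ (32 * q ^ 2)
      + δ (8 * q ^ 2 + q) + (∑ b, δ (32 * q ^ 2 + q * H b) - δ (32 * q ^ 2 + q * H 0)) := by
  classical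
  have h1 : weightCount (LinearMap.range Φ) w = Nat.card {u // hammingNorm (Φ u) = w} :=
    (Nat.card_congr ((LinearEquiv.ofInjective Φ hw.injective).toEquiv.subtypeEquiv
      fun u => Iff.rfl)).symm
  have h2 (u : ZMod 2 × V) :
      (if hammingNorm (Φ u) = w then 1 else 0 : ℤ) = δ (hammingNorm (Φ u)) := by
    rw [hδ]
    norm_cast
  rw [h1, Nat.card_eq_fintype_card, Fintype.card_subtype, Finset.card_filter]
  push_cast
  simp_rw [h2]
  have hU : (Finset.univ : Finset (ZMod 2)) = {0, 1} := rfl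
  rw [Fintype.sum_prod_type, hU, Finset.sum_pair zero_ne_one,
    Fintype.sum_eq_add_sum_subtype_ne _ (0 : V), Fintype.sum_eq_add_sum_subtype_ne _ (0 : V),
    Fintype.sum_eq_add_sum_subtype_ne (fun b => δ (32 * q ^ 2 + q * H b)) (0 : V),
    Finset.sum_congr rfl fun (b : {b : V // b ≠ 0}) _ => congrArg δ (hw.zero b b.2),
    Finset.sum_congr rfl fun (b : {b : V // b ≠ 0}) _ => congrArg δ (hw.one b b.2),
    hw.one_zero, Prod.mk_zero_zero, map_zero, hammingNorm_zero]
  have hc := Fintype.sum_eq_add_sum_subtype_ne (fun _ : V => (1 : ℤ)) 0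
  simp only [Finset.sum_const, Finset.card_univ, nsmul_eq_mul, mul_one, Nat.cast_zero] at hc ⊢
  rw [hc]
  ring

end HasCubicWeights

theorem hasWeightDistribution_of_sum {ι : Type*} [Fintype ι] {C : Submodule (ZMod 2) (ι → ZMod 2)}
    {T : List (ℤ × ℤ)} (hT : (T.map Prod.fst).Nodup) (hpos : ∀ r ∈ T, 0 ≤ r.1)
    (hC : ∀ (w : ℕ) (δ : ℤ → ℤ), (∀ x, δ x = if x = w then 1 else 0) →
      (weightCount C w : ℤ) = (T.map fun r => r.2 * δ r.1).sum) :
    HasWeightDistribution C T := by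
  have hzero (w : ℤ) (T : List (ℤ × ℤ)) (h : w ∉ T.map Prod.fst) :
      (T.map fun r => r.2 * if r.1 = w then 1 else 0).sum = 0 := by
    apply List.sum_eq_zero
    intro x hx
    obtain ⟨r, hr, rfl⟩ := List.mem_map.1 hx
    rw [if_neg, mul_zero]
    rintro rfl
    exact h (List.mem_map_of_mem hr)
  refine ⟨hT, fun r hr => ?_, fun w h => ?_⟩
  · lift r.1 to ℕ using hpos r hr with w hw
    refine ⟨w, rfl, ?_⟩
    rw [hC w _ fun x => rfl, hw]
    clear hC hpos hw
    induction T with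
    | nil => simp at hr
    | cons s T ih =>
      rw [List.map_cons, List.nodup_cons] at hT
      rw [List.map_cons, List.sum_cons]
      rcases List.mem_cons.1 hr with rfl | hr
      · rw [hzero _ _ hT.1, if_pos rfl, mul_one, add_zero]
      · rw [ih hT.2 hr, if_neg, mul_zero, zero_add]
        intro h
        exact hT.1 (h ▸ List.mem_map_of_mem hr)
  · have := hC w _ fun x => rfl
    rw [hzero _ _ h] at this
    exact_mod_cast this

end CodeParameters

section Tables

theorem hasWeightDistribution_tableFull {ι : Type*} [Fintype ι]
    {C : Submodule (ZMod 2) (ι → ZMod 2)} {m : ℕ} (hm : 7 ≤ m) {p : ℤ} (hp : p = 2 ^ (m - 7))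
    (hC : ∀ (w : ℕ) (δ : ℤ → ℤ), (∀ x, δ x = if x = w then 1 else 0) →
      (weightCount C w : ℤ) = δ 0 + (64 * (16 * p) ^ 2 - 1) * δ (32 * (16 * p) ^ 2)
        + δ (8 * (16 * p) ^ 2 + 16 * p)
        + (8 * (16 * p) + 1) * (p * (δ (32 * (16 * p) ^ 2 + 16 * p * 7)
          + 7 * δ (32 * (16 * p) ^ 2 + 16 * p * 5) + 21 * δ (32 * (16 * p) ^ 2 + 16 * p * 3)
          + 35 * δ (32 * (16 * p) ^ 2 + 16 * p * 1) + 35 * δ (32 * (16 * p) ^ 2 + 16 * p * (-1))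
          + 21 * δ (32 * (16 * p) ^ 2 + 16 * p * (-3)) + 7 * δ (32 * (16 * p) ^ 2 + 16 * p * (-5))
          + δ (32 * (16 * p) ^ 2 + 16 * p * (-7))) - δ (32 * (16 * p) ^ 2 + 16 * p * 1))) :
    HasWeightDistribution C (tableFull m) := by
  have hp1 : 1 ≤ p := hp ▸ one_le_pow₀ (by norm_num)
  have hT : tableFull m =
      [(0, 1), (2048 * p ^ 2 + 16 * p, 1),
       (8192 * p ^ 2 - 16 * p, 35 * (128 * p ^ 2 + p)),
       (8192 * p ^ 2 + 16 * p, 35 * (128 * p ^ 2 + p) - (128 * p + 1)),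
       (8192 * p ^ 2 - 3 * (16 * p), 21 * (128 * p ^ 2 + p)),
       (8192 * p ^ 2 + 3 * (16 * p), 21 * (128 * p ^ 2 + p)),
       (8192 * p ^ 2 - 5 * (16 * p), 7 * (128 * p ^ 2 + p)),
       (8192 * p ^ 2 + 5 * (16 * p), 7 * (128 * p ^ 2 + p)),
       (8192 * p ^ 2 - 7 * (16 * p), 128 * p ^ 2 + p),
       (8192 * p ^ 2 + 7 * (16 * p), 128 * p ^ 2 + p),
       (8192 * p ^ 2, 16384 * p ^ 2 - 1)] := by
    obtain ⟨k, rfl⟩ := Nat.exists_eq_add_of_le' hm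
    rw [Nat.add_sub_cancel] at hp
    have e1 : (2 : ℤ) ^ (2 * (k + 7)) = 16384 * p ^ 2 := by rw [hp]; ring
    have e2 : (2 : ℤ) ^ (2 * (k + 7) - 1) = 8192 * p ^ 2 := by
      rw [show 2 * (k + 7) - 1 = 2 * k + 13 by omega, hp]; ring
    have e3 : (2 : ℤ) ^ (2 * (k + 7) - 3) = 2048 * p ^ 2 := by
      rw [show 2 * (k + 7) - 3 = 2 * k + 11 by omega, hp]; ring
    have e4 : (2 : ℤ) ^ (2 * (k + 7) - 7) = 128 * p ^ 2 := by
      rw [show 2 * (k + 7) - 7 = 2 * k + 7 by omega, hp]; ring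
    have e5 : (2 : ℤ) ^ (k + 7 - 3) = 16 * p := by
      rw [show k + 7 - 3 = k + 4 by omega, hp]; ring
    have e6 : (2 : ℤ) ^ (k + 7 - 7) = p := by rw [Nat.add_sub_cancel, hp]
    have e7 : (2 : ℤ) ^ (k + 7) = 128 * p := by rw [hp]; ring
    rw [tableFull, e1, e2, e3, e4, e5, e6, e7]
  have hsq := Int.le_self_sq p
  rw [hT]
  refine hasWeightDistribution_of_sum ?_ ?_ fun w δ hδ => ?_
  · simp only [List.map_cons, List.map_nil, List.nodup_cons, List.mem_cons, List.not_mem_nil,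
      or_false, not_or, not_false_eq_true, List.nodup_nil, and_true]
    repeat' apply And.intro
    all_goals (intro h; linarith)
  · simp only [List.forall_mem_cons, List.not_mem_nil, false_imp_iff, implies_true, and_true]
    repeat' apply And.intro
    all_goals linarith
  · rw [hC w δ hδ]
    simp only [List.map_cons, List.map_nil, List.sum_cons, List.sum_nil]
    ring_nf

theorem hasWeightDistribution_tableDeficient {ι : Type*} [Fintype ι]
    {C : Submodule (ZMod 2) (ι → ZMod 2)} {m : ℕ} (hm : 6 ≤ m) {p : ℤ} (hp : p = 2 ^ (m - 6))
    (hC : ∀ (w : ℕ) (δ : ℤ → ℤ), (∀ x, δ x = if x = w then 1 else 0) →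
      (weightCount C w : ℤ) = δ 0 + (64 * (8 * p) ^ 2 - 1) * δ (32 * (8 * p) ^ 2)
        + δ (8 * (8 * p) ^ 2 + 8 * p)
        + (8 * (8 * p) + 1) * (p * (3 * δ (32 * (8 * p) ^ 2 + 8 * p * 5)
          + 12 * δ (32 * (8 * p) ^ 2 + 8 * p * 3)
          + 19 * δ (32 * (8 * p) ^ 2 + 8 * p * 1) + 16 * δ (32 * (8 * p) ^ 2 + 8 * p * (-1))
          + 9 * δ (32 * (8 * p) ^ 2 + 8 * p * (-3)) + 4 * δ (32 * (8 * p) ^ 2 + 8 * p * (-5))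
          + δ (32 * (8 * p) ^ 2 + 8 * p * (-7))) - δ (32 * (8 * p) ^ 2 + 8 * p * 1))) :
    HasWeightDistribution C (tableDeficient m) := by
  have hp1 : 1 ≤ p := hp ▸ one_le_pow₀ (by norm_num)
  have hT : tableDeficient m =
      [(0, 1), (512 * p ^ 2 + 8 * p, 1),
       (2048 * p ^ 2 - 7 * (8 * p), 64 * p ^ 2 + p),
       (2048 * p ^ 2 - 8 * p, 16 * (64 * p ^ 2 + p)),
       (2048 * p ^ 2 + 8 * p, 19 * (64 * p ^ 2 + p) - (64 * p + 1)),
       (2048 * p ^ 2 - 3 * (8 * p), 9 * (64 * p ^ 2 + p)),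
       (2048 * p ^ 2 + 3 * (8 * p), 12 * (64 * p ^ 2 + p)),
       (2048 * p ^ 2 - 5 * (8 * p), 4 * (64 * p ^ 2 + p)),
       (2048 * p ^ 2 + 5 * (8 * p), 3 * (64 * p ^ 2 + p)),
       (2048 * p ^ 2, 4096 * p ^ 2 - 1)] := by
    obtain ⟨k, rfl⟩ := Nat.exists_eq_add_of_le' hm
    rw [Nat.add_sub_cancel] at hp
    have e1 : (2 : ℤ) ^ (2 * (k + 6)) = 4096 * p ^ 2 := by rw [hp]; ring
    have e2 : (2 : ℤ) ^ (2 * (k + 6) - 1) = 2048 * p ^ 2 := by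
      rw [show 2 * (k + 6) - 1 = 2 * k + 11 by omega, hp]; ring
    have e3 : (2 : ℤ) ^ (2 * (k + 6) - 3) = 512 * p ^ 2 := by
      rw [show 2 * (k + 6) - 3 = 2 * k + 9 by omega, hp]; ring
    have e4 : (2 : ℤ) ^ (2 * (k + 6) - 6) = 64 * p ^ 2 := by
      rw [show 2 * (k + 6) - 6 = 2 * k + 6 by omega, hp]; ring
    have e5 : (2 : ℤ) ^ (k + 6 - 3) = 8 * p := by
      rw [show k + 6 - 3 = k + 3 by omega, hp]; ring
    have e6 : (2 : ℤ) ^ (k + 6 - 6) = p := by rw [Nat.add_sub_cancel, hp]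
    have e7 : (2 : ℤ) ^ (k + 6) = 64 * p := by rw [hp]; ring
    rw [tableDeficient, e1, e2, e3, e4, e5, e6, e7]
  have hsq := Int.le_self_sq p
  rw [hT]
  refine hasWeightDistribution_of_sum ?_ ?_ fun w δ hδ => ?_
  · simp only [List.map_cons, List.map_nil, List.nodup_cons, List.mem_cons, List.not_mem_nil,
      or_false, not_or, not_false_eq_true, List.nodup_nil, and_true]
    repeat' apply And.intro
    all_goals (intro h; linarith)
  · simp only [List.forall_mem_cons, List.not_mem_nil, false_imp_iff, implies_true, and_true]
    repeat' apply And.intro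
    all_goals linarith
  · rw [hC w δ hδ]
    simp only [List.map_cons, List.map_nil, List.sum_cons, List.sum_nil]
    ring_nf

end Tables

section StarCode

theorem invSumChar_right_comm {K : Type*} [Field K] [Algebra (ZMod 2) K] (a b c z : K) :
    invSumChar a c b z = invSumChar a b c z := by
  simp only [invSumChar, add_comm c b, add_right_comm a c b]
  ring

theorem invSumChar_rotate {K : Type*} [Field K] [Algebra (ZMod 2) K] (a b c z : K) :
    invSumChar b c a z = invSumChar a b c z := by
  simp only [invSumChar, add_comm c a, add_comm b a, show b + c + a = a + b + c by ring]
  ring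

theorem inverseSums_right_comm {K : Type*} [Field K] (a b c : K) :
    inverseSums ![a, c, b] = inverseSums ![a, b, c] := by
  ext x
  simp [inverseSums, add_comm c b, add_right_comm a c b]
  tauto

theorem inverseSums_rotate {K : Type*} [Field K] (a b c : K) :
    inverseSums ![b, c, a] = inverseSums ![a, b, c] := by
  ext x
  simp [inverseSums, add_comm c a, add_comm b a, show b + c + a = a + b + c by ring]
  tauto

theorem linearIndependent_inv_of_finrank {K : Type*} [Field K] [Finite K] [Algebra (ZMod 2) K]
    {a b c : K}
    (h : 7 ≤ Module.finrank (ZMod 2) (Submodule.span (ZMod 2) (inverseSums ![a, b, c]))) :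
    LinearIndependent (ZMod 2)
      ![a⁻¹, b⁻¹, c⁻¹, (a + b)⁻¹, (a + c)⁻¹, (b + c)⁻¹, (a + b + c)⁻¹] := by
  refine linearIndependent_of_le_finrank_span ?_ h
  refine Set.Subset.trans ?_ Submodule.subset_span
  intro x hx
  simp [inverseSums] at hx
  simp
  tauto

theorem linearIndependent_inv_of_inv_add {K : Type*} [Field K] [Finite K] [Algebra (ZMod 2) K]
    {a b c : K} (hab : (a + b)⁻¹ = a⁻¹ + b⁻¹)
    (h : 6 ≤ Module.finrank (ZMod 2) (Submodule.span (ZMod 2) (inverseSums ![a, b, c]))) :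
    LinearIndependent (ZMod 2) ![a⁻¹, b⁻¹, c⁻¹, (a + c)⁻¹, (b + c)⁻¹, (a + b + c)⁻¹] := by
  refine linearIndependent_of_le_finrank_span ?_ h
  intro x hx
  by_cases hx2 : x = (a + b)⁻¹
  · rw [hx2, hab]
    exact add_mem (Submodule.subset_span ⟨0, rfl⟩) (Submodule.subset_span ⟨1, rfl⟩)
  · refine Submodule.subset_span ?_
    simp [inverseSums, hx2] at hx
    simp
    tauto

variable {K L : Type*} [Field K] [Field L] [Fintype L] [DecidableEq L]
  [Algebra (ZMod 2) K] [Algebra (ZMod 2) L] [Algebra K L] {m : ℕ}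
  (hK : Nat.card K = 2 ^ m) (hL : Nat.card L = 2 ^ (2 * m)) {lam : Fin 3 → K}

theorem hasCubicWeights_codewordMap (hlam : LinearIndependent (ZMod 2) lam) (hm : 3 ≤ m) :
    HasCubicWeights (codewordMap (cubicFun hK hL lam : L → ZMod 2))
      (fun b => invSumChar (lam 0) (lam 1) (lam 2) (Algebra.norm K b)) (2 ^ (m - 3)) := by
  have hq : (2 : ℤ) ^ m = 8 * 2 ^ (m - 3) := by
    obtain ⟨k, rfl⟩ := Nat.exists_eq_add_of_le' hm
    rw [Nat.add_sub_cancel, pow_add]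
    ring
  exact ⟨one_le_pow₀ one_le_two, fun b => abs_invSumChar_le _ _ _ _,
    fun b hb => hammingNorm_codewordMap_zero hL _ hb hq,
    hammingNorm_codewordMap_one_zero hK hL hlam hq,
    fun b hb => hammingNorm_codewordMap_one hK hL hlam hq hb⟩

theorem weightCount_starCode [Fintype K] (hlam : LinearIndependent (ZMod 2) lam) (hm : 3 ≤ m)
    {q : ℤ} (hq : q = 2 ^ (m - 3)) (w : ℕ) (δ : ℤ → ℤ) (hδ : ∀ x, δ x = if x = w then 1 else 0) :
    (weightCount (starCode (cubicFun hK hL lam : L → ZMod 2)) w : ℤ) =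
      δ 0 + (64 * q ^ 2 - 1) * δ (32 * q ^ 2) + δ (8 * q ^ 2 + q)
        + (8 * q + 1) * (∑ y, δ (32 * q ^ 2 + q * invSumChar (lam 0) (lam 1) (lam 2) y)
          - δ (32 * q ^ 2 + q * 1)) := by
  have h := (hasCubicWeights_codewordMap hK hL hlam hm).weightCount_eq w δ hδ
  have hm2 : (2 : ℤ) ^ m = 8 * q := by
    obtain ⟨k, rfl⟩ := Nat.exists_eq_add_of_le' hm
    rw [hq, Nat.add_sub_cancel, pow_add]
    ring
  rw [← hq, sum_norm hK hL fun y => δ (32 * q ^ 2 + q * invSumChar (lam 0) (lam 1) (lam 2) y),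
    Algebra.norm_zero, invSumChar_zero, ← Nat.card_eq_fintype_card, hL, Nat.cast_pow, Nat.cast_two,
    mul_comm 2 m, pow_mul, hm2] at h
  rw [starCode, h]
  ring

theorem isLinearCode_starCode (hlam : LinearIndependent (ZMod 2) lam) (hm : 3 ≤ m) :
    IsLinearCode (starCode (cubicFun hK hL lam : L → ZMod 2))
      (2 ^ (2 * m) - 1) (2 * m + 1) (2 ^ (2 * m - 3) + 2 ^ (m - 3)) := by
  have hw := hasCubicWeights_codewordMap hK hL hlam hm
  refine ⟨?_, ?_, hw.isLeast ?_⟩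
  · rw [Fintype.card_subtype_compl, Fintype.card_subtype_eq, ← Nat.card_eq_fintype_card, hL]
  · have h := Module.natCard_eq_pow_finrank (K := ZMod 2) (V := L)
    rw [hL, Nat.card_zmod] at h
    rw [starCode, LinearMap.finrank_range_of_inj hw.injective, Module.finrank_prod,
      Module.finrank_self, ← Nat.pow_right_injective le_rfl h, add_comm]
  · obtain ⟨k, rfl⟩ := Nat.exists_eq_add_of_le' hm
    rw [Nat.add_sub_cancel, show 2 * (k + 3) - 3 = 2 * k + 3 by omega]
    push_cast
    ring

theorem hasWeightDistribution_starCode_full (hlam : LinearIndependent (ZMod 2) lam)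
    (hrank : 7 ≤ Module.finrank (ZMod 2) (Submodule.span (ZMod 2) (inverseSums lam))) :
    HasWeightDistribution (starCode (cubicFun hK hL lam : L → ZMod 2)) (tableFull m) := by
  have : Finite K := Finite.of_injective _ (algebraMap K L).injective
  have := Fintype.ofFinite K
  have he := linearIndependent_inv_of_finrank (a := lam 0) (b := lam 1) (c := lam 2) hrank
  have hm := le_of_linearIndependent hK he
  refine hasWeightDistribution_tableFull hm rfl fun w δ hδ => ?_
  have hq : (16 * 2 ^ (m - 7) : ℤ) = 2 ^ (m - 3) := by
    obtain ⟨k, rfl⟩ := Nat.exists_eq_add_of_le' hm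
    rw [Nat.add_sub_cancel, show k + 7 - 3 = k + 4 by omega]
    ring
  rw [weightCount_starCode hK hL hlam (by omega) hq w δ hδ]
  have hs := sum_invSumChar_of_linearIndependent he
    fun h => δ (32 * (16 * 2 ^ (m - 7)) ^ 2 + 16 * 2 ^ (m - 7) * h)
  rw [← Nat.card_eq_fintype_card, hK, Nat.cast_pow, Nat.cast_two, ← Nat.add_sub_of_le hm, pow_add,
    Nat.add_sub_of_le hm, mul_assoc] at hs
  rw [mul_left_cancel₀ (by norm_num) hs]

theorem hasWeightDistribution_starCode_deficient (hlam : LinearIndependent (ZMod 2) lam)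
    {a b c : K} (hab : (a + b)⁻¹ = a⁻¹ + b⁻¹)
    (hchar : ∀ z, invSumChar (lam 0) (lam 1) (lam 2) z = invSumChar a b c z)
    (hrank : 6 ≤ Module.finrank (ZMod 2) (Submodule.span (ZMod 2) (inverseSums ![a, b, c]))) :
    HasWeightDistribution (starCode (cubicFun hK hL lam : L → ZMod 2)) (tableDeficient m) := by
  have : Finite K := Finite.of_injective _ (algebraMap K L).injective
  have := Fintype.ofFinite K
  have he := linearIndependent_inv_of_inv_add hab hrank
  have hm := le_of_linearIndependent hK he
  refine hasWeightDistribution_tableDeficient hm rfl fun w δ hδ => ?_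
  have hq : (8 * 2 ^ (m - 6) : ℤ) = 2 ^ (m - 3) := by
    obtain ⟨k, rfl⟩ := Nat.exists_eq_add_of_le' hm
    rw [Nat.add_sub_cancel, show k + 6 - 3 = k + 3 by omega]
    ring
  rw [weightCount_starCode hK hL hlam (by omega) hq w δ hδ]
  simp_rw [hchar]
  have hs := sum_invSumChar_of_inv_add hab he
    fun h => δ (32 * (8 * 2 ^ (m - 6)) ^ 2 + 8 * 2 ^ (m - 6) * h)
  rw [← Nat.card_eq_fintype_card, hK, Nat.cast_pow, Nat.cast_two, ← Nat.add_sub_of_le hm, pow_add,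
    Nat.add_sub_of_le hm, mul_assoc] at hs
  rw [mul_left_cancel₀ (by norm_num) hs]

end StarCode

theorem theorem2 {K L : Type*} [Field K] [Field L] [Fintype L] [DecidableEq L]
    [Algebra (ZMod 2) K] [Algebra (ZMod 2) L] [Algebra K L] (m : ℕ)
    (hK : Nat.card K = 2 ^ m) (hL : Nat.card L = 2 ^ (2 * m)) (lam : Fin 3 → K)
    (hlam : LinearIndependent (ZMod 2) lam)
    (hrank : Module.finrank (ZMod 2) (Submodule.span (ZMod 2) (inverseSums lam)) =
      hammingNorm (tVec lam) + 3) :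
    IsLinearCode (starCode (cubicFun hK hL lam : L → ZMod 2))
        (2 ^ (2 * m) - 1) (2 * m + 1) (2 ^ (2 * m - 3) + 2 ^ (m - 3)) ∧
      IsMinimalCode (starCode (cubicFun hK hL lam : L → ZMod 2)) ∧
      (∃ wmin wmax : ℕ,
        IsLeast (nonzeroWeights (starCode (cubicFun hK hL lam : L → ZMod 2))) wmin ∧
        IsGreatest (nonzeroWeights (starCode (cubicFun hK hL lam : L → ZMod 2))) wmax ∧
        (wmin : ℚ) / wmax < 1 / 2) ∧
      (tVec lam = ![1, 1, 1, 1] →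
        HasWeightDistribution (starCode (cubicFun hK hL lam : L → ZMod 2)) (tableFull m)) ∧
      (tVec lam 0 = 1 ∧ hammingNorm ![tVec lam 1, tVec lam 2, tVec lam 3] = 2 →
        HasWeightDistribution (starCode (cubicFun hK hL lam : L → ZMod 2))
          (tableDeficient m)) := by
  have : Finite K := Finite.of_injective _ (algebraMap K L).injective
  have := Fintype.ofFinite K
  have hm := le_of_linearIndependent hK hlam
  have hw := hasCubicWeights_codewordMap hK hL hlam hm
  refine ⟨isLinearCode_starCode hK hL hlam hm, hw.isMinimalCode, hw.exists_weight_ratio_lt,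
    fun ht => ?_, fun ht => ?_⟩
  · refine hasWeightDistribution_starCode_full hK hL hlam ?_
    rw [hrank, ht]
    decide
  · have key : ∀ a b c d : ZMod 2, a = 1 ∧ hammingNorm ![b, c, d] = 2 →
        hammingNorm ![a, b, c, d] = 3 ∧ (b = 0 ∨ c = 0 ∨ d = 0) := by decide
    have ht' : tVec lam = ![tVec lam 0, tVec lam 1, tVec lam 2, tVec lam 3] := rfl
    obtain ⟨h3, h0⟩ := key _ _ _ _ ht
    rw [ht', h3] at hrank
    have hlam3 : inverseSums lam = inverseSums ![lam 0, lam 1, lam 2] := rfl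
    rw [hlam3] at hrank
    have of_ite {P : Prop} {_ : Decidable P} (h : (if P then 0 else 1 : ZMod 2) = 0) : P := by
      by_contra hP
      rw [if_neg hP] at h
      exact one_ne_zero h
    rcases h0 with h0 | h0 | h0
    · exact hasWeightDistribution_starCode_deficient hK hL hlam (of_ite h0) (fun z => rfl) hrank.ge
    · refine hasWeightDistribution_starCode_deficient hK hL hlam (of_ite h0)
        (fun z => (invSumChar_right_comm _ _ _ z).symm) ?_
      rw [inverseSums_right_comm]
      exact hrank.ge
    · refine hasWeightDistribution_starCode_deficient hK hL hlam (of_ite h0)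
        (fun z => (invSumChar_rotate _ _ _ z).symm) ?_
      rw [inverseSums_rotate]
      exact hrank.ge
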